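/- Let $n \ge 1$, let $A$ and $\Sigma$ be real symmetric positive definite $n \times n$ matrices, let $\mu \in \mathbb{R}^n$, let $x \sim \mathcal{N}(\mu, \Sigma)$ be an $n$-dimensional Gaussian random vector, and let $Q = x^T A x$. Let $P$ be any orthogonal $n\times n$ matrix with $P^T \Sigma^{1/2} A \Sigma^{1/2} P = \mathrm{diag}(\lambda_1, \dots, \lambda_n)$, where $\Sigma^{1/2}$ is the positive definite square root of $\Sigma$ (so that $\lambda_1,\dots,\lambda_n > 0$ are the eigenvalues of $\Sigma^{1/2} A \Sigma^{1/2}$), and put $b = (b_1,\dots,b_n)^T = P^T \Sigma^{-1/2} \mu$. Define $$d_k = \frac12 \sum_{i=1}^n (1 - k b_i^2)(2\lambda_i)^{-k} \quad (k \ge 1),$$ $$c_0 = \exp\Big(-\frac12 \sum_{i=1}^n b_i^2\Big) \prod_{i=1}^n (2\lambda_i)^{-1/2}, \qquad c_k = \frac1k \sum_{j=0}^{k-1} d_{k-j}\, c_j \quad (k \ge 1).$$ Then the cumulative distribution function of $Q$ is $$F(y) = \mathbb{P}(Q \le y) = \sum_{k=0}^\infty (-1)^k c_k \frac{y^{n/2+k}}{\Gamma(n/2+k+1)}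 \quad (y \ge 0), \qquad F(y) = 0 \quad (y < 0),$$ and the law of $Q$ is absolutely continuous with respect to Lebesgue measure, with probability density function $$p(y) = \sum_{k=0}^\infty (-1)^k c_k \frac{y^{n/2+k-1}}{\Gamma(n/2+k)} \ge 0 \quad (y > 0), \qquad p(y) = 0 \quad (y \le 0).$$ Both series converge absolutely for every $y$ in the stated ranges. -/

import Mathlib

open scoped MatrixOrder

noncomputable section

namespace QuadFormSeries

/-- The quadratic form `xᵀ A x = ∑ i, ∑ j, a i j * x i * x j`. -/
def quadForm {n : ℕ} (A : Matrix (Fin n) (Fin n) ℝ) (x : EuclideanSpace ℝ (Fin n)) : ℝ :=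
  ∑ i, ∑ j, A i j * x i * x j

/-- `lam` and `b` are the parameters, obtained from the orthogonal matrix `P`, of the quadratic
form with matrix `A` in a random vector with mean `mu` and covariance matrix `S`:
`P` is orthogonal, `Pᵀ (S^{1/2} A S^{1/2}) P = diag lam` and `b = Pᵀ S^{-1/2} mu`.
Here `CFC.sqrt S` is the positive semidefinite square root of `S`. -/
structure IsParam {n : ℕ} (A S : Matrix (Fin n) (Fin n) ℝ) (mu : EuclideanSpace ℝ (Fin n))
    (P : Matrix (Fin n) (Fin n) ℝ) (lam b : Fin n → ℝ) : Prop where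
  orthogonal : P ∈ Matrix.orthogonalGroup (Fin n) ℝ
  diagonalizes : P.transpose * (CFC.sqrt S * A * CFC.sqrt S) * P = Matrix.diagonal lam
  shift : b = P.transpose.mulVec ((CFC.sqrt S)⁻¹.mulVec mu.ofLp)

/-- `d_k = (1/2) ∑ i, (1 - k b_i²) (2 lam_i)^{-k}`, used for `k ≥ 1`. -/
def dCoeff {n : ℕ} (lam b : Fin n → ℝ) (k : ℕ) : ℝ :=
  (1 / 2) * ∑ i, (1 - (k : ℝ) * b i ^ 2) * ((2 * lam i) ^ k)⁻¹

/-- `c_0 = exp(-(1/2) ∑ i, b_i²) ∏ i, (2 lam_i)^{-1/2}` and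
`c_k = (1/k) ∑_{j=0}^{k-1} d_{k-j} c_j` for `k ≥ 1`. -/
def cCoeff {n : ℕ} (lam b : Fin n → ℝ) : ℕ → ℝ
  | 0 => Real.exp (-(1 / 2) * ∑ i, b i ^ 2) * ∏ i, (2 * lam i) ^ (-(1 / 2) : ℝ)
  | k + 1 => (1 / ((k : ℝ) + 1)) *
      ∑ j : Fin (k + 1), dCoeff lam b (k + 1 - (j : ℕ)) * cCoeff lam b (j : ℕ)
decreasing_by exact j.isLt

theorem cCoeff_zero {n : ℕ} (lam b : Fin n → ℝ) :
    cCoeff lam b 0 =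
      Real.exp (-(1 / 2) * ∑ i, b i ^ 2) * ∏ i, (2 * lam i) ^ (-(1 / 2) : ℝ) := by
  rw [cCoeff]

theorem cCoeff_of_pos {n : ℕ} (lam b : Fin n → ℝ) {k : ℕ} (hk : 1 ≤ k) :
    cCoeff lam b k =
      (1 / (k : ℝ)) * ∑ j ∈ Finset.range k, dCoeff lam b (k - j) * cCoeff lam b j := by
  obtain ⟨m, rfl⟩ : ∃ m, k = m + 1 := ⟨k - 1, by omega⟩
  rw [cCoeff, Finset.sum_range]
  push_cast
  rfl

end QuadFormSeries

end

/-!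
In the coordinates `x = mu + S^{1/2} P z`, with `z` standard Gaussian, the quadratic form is
`∑ i, lam i * (b i + z i) ^ 2` (`IsParam.quadForm_eq`, `map_quadForm_eq`), a sum of independent
one-dimensional noncentral squares. The series expansion is first proved for one square and then
carried through the sum by convolution.

Write `κ_a(y) = y ^ (a - 1) / Γ(a)` on the positive half-line. Euler's beta integral says that
`κ_s * κ_t = κ_{s + t}` (`integral_powerKernel_mul`). Hence a series `∑ gₖ κ_{a + k}` convolved with
`∑ hₖ κ_{b + k}` is `∑ (g h)ₖ κ_{a + b + k}`, where `g h` is the product of formal power series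
(`kernelSeries_convolution`). The exchange of sum and integral is justified because
`∑ |gₖ| rᵏ / k!` is finite for every `r`, a condition stable under products. Convolving with
`κ_1`, the Heaviside function, gives the distribution function (`kernelSeries_integral_Iic`).

For one square `λ (b + Z)²` the density at `y` is a multiple of
`y ^ (-1/2) exp (-y / (2λ)) cosh (b √(y / λ))`, and multiplying the two power series gives coefficients that are Laguerre polynomials of order `-1/2` in `b² / 2`
(`kernelSeries_squareSeries`, `hasKernelDensity_map_mul_sq`). Their three-term recurrence is the
statement that the generating series `f` satisfies `t f' = D f`, where `D = ∑ d_k tᵏ` is built from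
the single pair `(λ, b)` (`X_mul_derivative_squareSeries`). Logarithmic derivatives add under
products, so the product over all coordinates solves the same equation with the full coefficients
`d_k`; comparing coefficients gives the recursion that defines `c_k` (`coeff_prod_squareSeries`).
The sign `(-1)ᵏ` is the substitution `t ↦ -t`, which is a ring homomorphism. No Laplace transform
has to be inverted.
-/

namespace QuadFormSeries

open MeasureTheory

/-! ### Fractional power kernels -/

/-- The Riemann–Liouville kernel `y ^ (a - 1) / Γ(a)` on the positive half-line, extended by zero.
It is the density whose Laplace transform is `s ^ (-a)`. -/
noncomputable def powerKernel (a y : ℝ) : ℝ :=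
  if 0 < y then y ^ (a - 1) / Real.Gamma a else 0

theorem powerKernel_of_pos (a : ℝ) {y : ℝ} (hy : 0 < y) :
    powerKernel a y = y ^ (a - 1) / Real.Gamma a := if_pos hy

theorem powerKernel_of_nonpos (a : ℝ) {y : ℝ} (hy : y ≤ 0) : powerKernel a y = 0 :=
  if_neg hy.not_gt

theorem powerKernel_nonneg {a : ℝ} (ha : 0 < a) (y : ℝ) : 0 ≤ powerKernel a y := by
  unfold powerKernel
  split_ifs with h
  · have := Real.Gamma_pos_of_pos ha
    positivity
  · exact le_rfl

theorem measurable_powerKernel (a : ℝ) : Measurable (powerKernel a) :=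
  Measurable.ite measurableSet_Ioi (by fun_prop) measurable_const

/-- Euler's beta integral, real form: `∫₀^y x^(s-1) (y-x)^(t-1) dx = y^(s+t-1) B(s,t)`. -/
theorem integral_rpow_mul_sub_rpow {s t y : ℝ} (hs : 0 < s) (ht : 0 < t) (hy : 0 < y) :
    ∫ x in (0)..y, x ^ (s - 1) * (y - x) ^ (t - 1) =
      y ^ (s + t - 1) * (Real.Gamma s * Real.Gamma t / Real.Gamma (s + t)) := by
  have h := Complex.betaIntegral_scaled (s : ℂ) (t : ℂ) hy
  rw [Complex.betaIntegral_eq_Gamma_mul_div _ _ (by simpa using hs) (by simpa using ht)] at h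
  have e : ∫ x in (0)..y, (x : ℂ) ^ ((s : ℂ) - 1) * ((y : ℂ) - x) ^ ((t : ℂ) - 1) =
      ∫ x in (0)..y, ((x ^ (s - 1) * (y - x) ^ (t - 1) : ℝ) : ℂ) := by
    refine intervalIntegral.integral_congr fun x hx => ?_
    rw [Set.uIcc_of_le hy.le] at hx
    rw [Complex.ofReal_mul, Complex.ofReal_cpow hx.1, Complex.ofReal_cpow (sub_nonneg.2 hx.2)]
    push_cast
    rfl
  rw [e, intervalIntegral.integral_ofReal] at h
  have h2 : (y : ℂ) ^ ((s : ℂ) + t - 1) = ((y ^ (s + t - 1) : ℝ) : ℂ) := by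
    rw [Complex.ofReal_cpow hy.le]
    push_cast
    rfl
  rw [h2, ← Complex.ofReal_add, Complex.Gamma_ofReal, Complex.Gamma_ofReal,
    Complex.Gamma_ofReal] at h
  exact_mod_cast h

theorem powerKernel_mul_sub_eq_indicator (s t y : ℝ) :
    (fun x => powerKernel s x * powerKernel t (y - x)) =
      (Set.Ioo 0 y).indicator fun x => x ^ (s - 1) * (y - x) ^ (t - 1) *
        (Real.Gamma s * Real.Gamma t)⁻¹ := by
  ext x
  by_cases h : x ∈ Set.Ioo 0 y
  · rw [Set.indicator_of_mem h, powerKernel_of_pos _ h.1, powerKernel_of_pos _ (sub_pos.2 h.2),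
      mul_inv]
    ring
  · rw [Set.indicator_of_notMem h]
    rcases le_or_gt x 0 with hx | hx
    · rw [powerKernel_of_nonpos _ hx, zero_mul]
    · have : y ≤ x := by
        by_contra hxy
        exact h ⟨hx, not_le.1 hxy⟩
      rw [powerKernel_of_nonpos _ (sub_nonpos.2 this), mul_zero]

/-- The kernels form a convolution semigroup. -/
theorem integral_powerKernel_mul {s t : ℝ} (hs : 0 < s) (ht : 0 < t) (y : ℝ) :
    ∫ x, powerKernel s x * powerKernel t (y - x) = powerKernel (s + t) y := by
  rw [powerKernel_mul_sub_eq_indicator, integral_indicator measurableSet_Ioo,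
    ← integral_Ioc_eq_integral_Ioo]
  rcases le_or_gt y 0 with hy | hy
  · rw [Set.Ioc_eq_empty_of_le hy, powerKernel_of_nonpos _ hy]
    simp
  · rw [← intervalIntegral.integral_of_le hy.le, intervalIntegral.integral_mul_const,
      integral_rpow_mul_sub_rpow hs ht hy, powerKernel_of_pos _ hy]
    have := (Real.Gamma_pos_of_pos hs).ne'
    have := (Real.Gamma_pos_of_pos ht).ne'
    field_simp

theorem integrable_powerKernel_mul {s t : ℝ} (hs : 0 < s) (ht : 0 < t) (y : ℝ) :
    Integrable fun x => powerKernel s x * powerKernel t (y - x) := by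
  rcases le_or_gt y 0 with hy | hy
  · rw [powerKernel_mul_sub_eq_indicator, Set.Ioo_eq_empty_of_le hy]
    simp
  · -- a nonzero Bochner integral certifies integrability
    refine Integrable.of_integral_ne_zero ?_
    rw [integral_powerKernel_mul hs ht, powerKernel_of_pos _ hy]
    have := Real.Gamma_pos_of_pos (add_pos hs ht)
    positivity

/-- `Γ(a + m)` grows at least like a geometric sequence times `m!`, because `a + j` is at least
`min a 1 * (j + 1)`. -/
theorem Gamma_add_nat_ge {a : ℝ} (ha : 0 < a) (m : ℕ) :
    Real.Gamma a * min a 1 ^ m * m.factorial ≤ Real.Gamma (a + m) := by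
  induction m with
  | zero => simp
  | succ m ih =>
    have hc : (0 : ℝ) ≤ min a 1 := by positivity
    have h1 : min a 1 * (m + 1) ≤ a + m := by
      have h2 := min_le_left a 1
      have h3 := min_le_right a 1
      nlinarith [mul_le_mul_of_nonneg_right h3 (Nat.cast_nonneg (α := ℝ) m)]
    have hG := Real.Gamma_pos_of_pos ha
    calc Real.Gamma a * min a 1 ^ (m + 1) * (m + 1).factorial
        = (min a 1 * (m + 1)) * (Real.Gamma a * min a 1 ^ m * m.factorial) := by
          rw [Nat.factorial_succ]
          push_cast
          ring
      _ ≤ (a + m) * Real.Gamma (a + m) := by gcongr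
      _ = Real.Gamma (a + (m + 1 : ℕ)) := by
          rw [← Real.Gamma_add_one (by positivity)]
          push_cast
          ring_nf

/-- At a fixed point the kernels of order `a + m` decay like the terms of an exponential series. -/
theorem exists_powerKernel_le {a : ℝ} (ha : 0 < a) (y : ℝ) :
    ∃ M r : ℝ, 0 ≤ M ∧ 0 ≤ r ∧
      ∀ m : ℕ, powerKernel (a + m) y ≤ M * (r ^ m / m.factorial) := by
  rcases le_or_gt y 0 with hy | hy
  · exact ⟨0, 0, le_rfl, le_rfl, fun m => by simp [powerKernel_of_nonpos _ hy]⟩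
  · have hc : (0 : ℝ) < min a 1 := by positivity
    have hG := Real.Gamma_pos_of_pos ha
    refine ⟨y ^ (a - 1) / Real.Gamma a, y / min a 1, by positivity, by positivity, fun m => ?_⟩
    rw [powerKernel_of_pos _ hy, show a + m - 1 = (a - 1) + m by ring, Real.rpow_add hy,
      Real.rpow_natCast]
    calc y ^ (a - 1) * y ^ m / Real.Gamma (a + m)
        ≤ y ^ (a - 1) * y ^ m / (Real.Gamma a * min a 1 ^ m * m.factorial) := by
          have := Gamma_add_nat_ge ha m
          gcongr
      _ = y ^ (a - 1) / Real.Gamma a * ((y / min a 1) ^ m / m.factorial) := by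
          rw [div_pow]
          field_simp

/-! ### Coefficient sequences of exponential type -/

/-- A formal power series `∑ gₖ tᵏ` whose Borel transform `∑ gₖ tᵏ / k!` converges absolutely
on the whole line. -/
def ExpSummable (g : PowerSeries ℝ) : Prop :=
  ∀ r : ℝ, 0 ≤ r → Summable fun k => |PowerSeries.coeff k g| * (r ^ k / k.factorial)

/-- An absolutely convergent double series may be summed along antidiagonals. -/
theorem hasSum_antidiagonal {f : ℕ × ℕ → ℝ} {S : ℝ} (hf : HasSum f S) :
    HasSum (fun n => ∑ q ∈ Finset.HasAntidiagonal.antidiagonal n, f q) S := by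
  have h := (Finset.HasAntidiagonal.sigmaAntidiagonalEquivProd.hasSum_iff).2 hf
  refine h.sigma fun n => ?_
  rw [← Finset.sum_coe_sort]
  exact hasSum_fintype _

theorem pow_add_div_factorial_le (i j : ℕ) {r : ℝ} (hr : 0 ≤ r) :
    r ^ (i + j) / (i + j).factorial ≤ r ^ i / i.factorial * (r ^ j / j.factorial) := by
  rw [div_mul_div_comm, ← pow_add]
  have h : (i.factorial * j.factorial : ℝ) ≤ (i + j).factorial := by
    exact_mod_cast Nat.le_of_dvd (Nat.factorial_pos _)
      (Nat.factorial_mul_factorial_dvd_factorial_add i j)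
  gcongr

theorem ExpSummable.summable_prod {g h : PowerSeries ℝ} (hg : ExpSummable g)
    (hh : ExpSummable h) {r : ℝ} (hr : 0 ≤ r) :
    Summable fun q : ℕ × ℕ => |PowerSeries.coeff q.1 g| * |PowerSeries.coeff q.2 h| *
      (r ^ (q.1 + q.2) / (q.1 + q.2).factorial) := by
  refine Summable.of_nonneg_of_le (fun q => by positivity) (fun q => ?_)
    ((hg r hr).mul_of_nonneg (hh r hr) (fun k => by positivity) (fun k => by positivity))
  calc _ ≤ |PowerSeries.coeff q.1 g| * |PowerSeries.coeff q.2 h| *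
        (r ^ q.1 / q.1.factorial * (r ^ q.2 / q.2.factorial)) := by
        gcongr
        exact pow_add_div_factorial_le _ _ hr
    _ = _ := by ring

theorem ExpSummable.mul {g h : PowerSeries ℝ} (hg : ExpSummable g) (hh : ExpSummable h) :
    ExpSummable (g * h) := by
  intro r hr
  refine Summable.of_nonneg_of_le (fun q => by positivity) (fun k => ?_)
    (hasSum_antidiagonal (hg.summable_prod hh hr).hasSum).summable
  rw [PowerSeries.coeff_mul]
  calc _ ≤ (∑ q ∈ Finset.HasAntidiagonal.antidiagonal k,
          |PowerSeries.coeff q.1 g * PowerSeries.coeff q.2 h|) * (r ^ k / k.factorial) := by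
        gcongr
        exact Finset.abs_sum_le_sum_abs _ _
    _ = _ := by
        rw [Finset.sum_mul]
        refine Finset.sum_congr rfl fun q hq => ?_
        rw [Finset.HasAntidiagonal.mem_antidiagonal.1 hq, abs_mul]

theorem expSummable_one : ExpSummable 1 := by
  intro r _
  refine summable_of_ne_finset_zero (s := {0}) fun k hk => ?_
  rw [PowerSeries.coeff_one, if_neg (by simpa using hk)]
  simp

/-! ### Series of fractional power kernels -/

/-- The series `∑ gₖ y ^ (a + k - 1) / Γ(a + k)` on the positive half-line, zero elsewhere. It is
the termwise inverse Laplace transform of `s ^ (-a) * g (1 / s)`. -/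
noncomputable def kernelSeries (a : ℝ) (g : PowerSeries ℝ) (y : ℝ) : ℝ :=
  ∑' k : ℕ, PowerSeries.coeff k g * powerKernel (a + k) y

theorem kernelSeries_of_nonpos (a : ℝ) (g : PowerSeries ℝ) {y : ℝ} (hy : y ≤ 0) :
    kernelSeries a g y = 0 := by
  simp [kernelSeries, powerKernel_of_nonpos _ hy]

theorem ExpSummable.summable_abs {g : PowerSeries ℝ} (hg : ExpSummable g) {a : ℝ} (ha : 0 < a)
    (y : ℝ) : Summable fun k : ℕ => ‖PowerSeries.coeff k g * powerKernel (a + k) y‖ := by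
  obtain ⟨M, r, hM, hr, h⟩ := exists_powerKernel_le ha y
  refine Summable.of_nonneg_of_le (fun k => norm_nonneg _) (fun k => ?_) ((hg r hr).mul_left M)
  rw [norm_mul, Real.norm_eq_abs, Real.norm_eq_abs,
    abs_of_nonneg (powerKernel_nonneg (by positivity) y)]
  calc _ ≤ |PowerSeries.coeff k g| * (M * (r ^ k / k.factorial)) := by
        gcongr
        exact h k
    _ = _ := by ring

theorem ExpSummable.hasSum {g : PowerSeries ℝ} (hg : ExpSummable g) {a : ℝ} (ha : 0 < a)
    (y : ℝ) :
    HasSum (fun k : ℕ => PowerSeries.coeff k g * powerKernel (a + k) y) (kernelSeries a g y) :=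
  (hg.summable_abs ha y).of_norm.hasSum

theorem ExpSummable.measurable_kernelSeries {g : PowerSeries ℝ} (hg : ExpSummable g) {a : ℝ}
    (ha : 0 < a) : Measurable (kernelSeries a g) := by
  refine measurable_of_tendsto_metrizable
    (f := fun (n : ℕ) y => ∑ k ∈ Finset.range n, PowerSeries.coeff k g * powerKernel (a + k) y)
    (fun n => ?_) (tendsto_pi_nhds.2 fun y => (hg.hasSum ha y).tendsto_sum_nat)
  exact Finset.measurable_sum _ fun k _ => (measurable_powerKernel _).const_mul _

/-- The sum of a series of functions whose `L¹` norms are summable is integrable. -/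
theorem integrable_tsum_of_summable_integral_norm {α ι : Type*} [MeasurableSpace α]
    {μ : Measure α} [Countable ι] {F : ι → α → ℝ}
    (hF : ∀ i, Integrable (F i) μ) (hs : Summable fun i => ∫ x, ‖F i x‖ ∂μ)
    (hm : AEStronglyMeasurable (fun x => ∑' i, F i x) μ) :
    Integrable (fun x => ∑' i, F i x) μ := by
  refine ⟨hm, ?_⟩
  calc ∫⁻ x, ‖∑' i, F i x‖ₑ ∂μ ≤ ∫⁻ x, ∑' i, ‖F i x‖ₑ ∂μ :=
        lintegral_mono fun x => enorm_tsum_le_tsum_enorm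
    _ = ∑' i, ∫⁻ x, ‖F i x‖ₑ ∂μ := lintegral_tsum fun i => (hF i).1.enorm
    _ = ∑' i, ENNReal.ofReal (∫ x, ‖F i x‖ ∂μ) := by
        simp_rw [ofReal_integral_norm_eq_lintegral_enorm (hF _)]
    _ = ENNReal.ofReal (∑' i, ∫ x, ‖F i x‖ ∂μ) :=
        (ENNReal.ofReal_tsum_of_nonneg (fun i => integral_nonneg fun x => norm_nonneg _) hs).symm
    _ < ⊤ := ENNReal.ofReal_lt_top

/-- Convolving two kernel series multiplies the coefficient series and adds the exponents. -/
theorem kernelSeries_convolution {a b : ℝ} (ha : 0 < a) (hb : 0 < b) {g h : PowerSeries ℝ}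
    (hg : ExpSummable g) (hh : ExpSummable h) (y : ℝ) :
    Integrable (fun x => kernelSeries a g x * kernelSeries b h (y - x)) ∧
      ∫ x, kernelSeries a g x * kernelSeries b h (y - x) = kernelSeries (a + b) (g * h) y := by
  let F : ℕ × ℕ → ℝ → ℝ := fun q x =>
    (PowerSeries.coeff q.1 g * powerKernel (a + q.1) x) *
      (PowerSeries.coeff q.2 h * powerKernel (b + q.2) (y - x))
  have hF : ∀ q, F q = fun x => PowerSeries.coeff q.1 g * PowerSeries.coeff q.2 h *
      (powerKernel (a + q.1) x * powerKernel (b + q.2) (y - x)) := fun q => by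
    ext x
    simp only [F]
    ring
  have hpos : ∀ q : ℕ × ℕ, 0 < a + q.1 ∧ 0 < b + q.2 := fun q => ⟨by positivity, by positivity⟩
  have hint : ∀ q, Integrable (F q) := fun q => by
    rw [hF]
    exact (integrable_powerKernel_mul (hpos q).1 (hpos q).2 y).const_mul _
  have hval : ∀ q : ℕ × ℕ, ∫ x, F q x = PowerSeries.coeff q.1 g * PowerSeries.coeff q.2 h *
      powerKernel (a + b + (q.1 + q.2 : ℕ)) y := fun q => by
    rw [hF, integral_const_mul, integral_powerKernel_mul (hpos q).1 (hpos q).2]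
    push_cast
    ring_nf
  have hnorm : ∀ q : ℕ × ℕ, ∫ x, ‖F q x‖ =
      |PowerSeries.coeff q.1 g| * |PowerSeries.coeff q.2 h| *
      powerKernel (a + b + (q.1 + q.2 : ℕ)) y := fun q => by
    have : (fun x => ‖F q x‖) = fun x => |PowerSeries.coeff q.1 g| * |PowerSeries.coeff q.2 h| *
        (powerKernel (a + q.1) x * powerKernel (b + q.2) (y - x)) := by
      ext x
      rw [hF, norm_mul, Real.norm_eq_abs, Real.norm_eq_abs, abs_mul, abs_of_nonneg
        (mul_nonneg (powerKernel_nonneg (hpos q).1 x) (powerKernel_nonneg (hpos q).2 (y - x)))]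
    rw [this, integral_const_mul, integral_powerKernel_mul (hpos q).1 (hpos q).2]
    push_cast
    ring_nf
  have hsum : Summable fun q => ∫ x, ‖F q x‖ := by
    obtain ⟨M, r, hM, hr, hle⟩ := exists_powerKernel_le (add_pos ha hb) y
    refine Summable.of_nonneg_of_le (fun q => integral_nonneg fun x => norm_nonneg _)
      (fun q => ?_) ((hg.summable_prod hh hr).mul_left M)
    rw [hnorm]
    calc _ ≤ |PowerSeries.coeff q.1 g| * |PowerSeries.coeff q.2 h| *
          (M * (r ^ (q.1 + q.2) / (q.1 + q.2).factorial)) := by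
          gcongr
          exact hle _
      _ = _ := by ring
  have htsum : (fun x => ∑' q, F q x) =
      fun x => kernelSeries a g x * kernelSeries b h (y - x) := by
    ext x
    exact (tsum_mul_tsum_of_summable_norm (hg.summable_abs ha x)
      (hh.summable_abs hb (y - x))).symm
  have hmeas : Measurable fun x => kernelSeries a g x * kernelSeries b h (y - x) :=
    (hg.measurable_kernelSeries ha).mul
      ((hh.measurable_kernelSeries hb).comp (measurable_const.sub measurable_id))
  rw [← htsum]
  refine ⟨integrable_tsum_of_summable_integral_norm hint hsum
    (htsum ▸ hmeas.aestronglyMeasurable), ?_⟩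
  have h1 := hasSum_antidiagonal (hasSum_integral_of_summable_integral_norm hint hsum)
  refine h1.unique ?_
  convert (hg.mul hh).hasSum (add_pos ha hb) y using 2 with k
  rw [PowerSeries.coeff_mul, Finset.sum_mul]
  refine Finset.sum_congr rfl fun q hq => ?_
  rw [hval, Finset.HasAntidiagonal.mem_antidiagonal.1 hq]

theorem kernelSeries_one_one (y : ℝ) : kernelSeries 1 1 y = if 0 < y then 1 else 0 := by
  have h : ∀ k : ℕ, k ≠ 0 →
      PowerSeries.coeff k (1 : PowerSeries ℝ) * powerKernel (1 + k) y = 0 := fun k hk => by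
    rw [PowerSeries.coeff_one, if_neg hk, zero_mul]
  rw [kernelSeries, tsum_eq_single 0 h]
  simp [powerKernel]

/-- The distribution function of a kernel series is the kernel series of the next order: integrating
is convolving with the kernel of order one, the Heaviside function. -/
theorem kernelSeries_integral_Iic {a : ℝ} (ha : 0 < a) {g : PowerSeries ℝ}
    (hg : ExpSummable g) (y : ℝ) :
    IntegrableOn (kernelSeries a g) (Set.Iic y) ∧
      ∫ x in Set.Iic y, kernelSeries a g x = kernelSeries (a + 1) g y := by
  have h := kernelSeries_convolution ha one_pos hg expSummable_one y
  have e : (fun x => kernelSeries a g x * kernelSeries 1 1 (y - x)) =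
      (Set.Iio y).indicator (kernelSeries a g) := by
    ext x
    rw [kernelSeries_one_one, Set.indicator_apply]
    simp [sub_pos]
  rw [e, mul_one, integrable_indicator_iff measurableSet_Iio,
    integral_indicator measurableSet_Iio] at h
  rw [integrableOn_Iic_iff_integrableOn_Iio, integral_Iic_eq_integral_Iio]
  exact h

/-! ### Measures whose density is a kernel series -/

/-- The measure `μ` has the nonnegative density `kernelSeries a g` with respect to Lebesgue
measure, where `g` is of exponential type. -/
structure HasKernelDensity (μ : Measure ℝ) (a : ℝ) (g : PowerSeries ℝ) : Prop where
  expSummable : ExpSummable g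
  nonneg : ∀ y, 0 ≤ kernelSeries a g y
  eq_withDensity : μ = volume.withDensity fun y => ENNReal.ofReal (kernelSeries a g y)

theorem HasKernelDensity.conv {μ ν : Measure ℝ} {a b : ℝ} (ha : 0 < a) (hb : 0 < b)
    {g h : PowerSeries ℝ} (hμ : HasKernelDensity μ a g) (hν : HasKernelDensity ν b h) :
    HasKernelDensity (μ.conv ν) (a + b) (g * h) := by
  have hc := kernelSeries_convolution ha hb hμ.expSummable hν.expSummable
  have hnn : ∀ y x, 0 ≤ kernelSeries a g x * kernelSeries b h (y - x) := fun y x =>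
    mul_nonneg (hμ.nonneg x) (hν.nonneg _)
  refine ⟨hμ.expSummable.mul hν.expSummable, fun y => ?_, ?_⟩
  · rw [← (hc y).2]
    exact integral_nonneg (hnn y)
  · rw [hμ.eq_withDensity, hν.eq_withDensity, conv_withDensity_eq_lconvolution
      (hμ.expSummable.measurable_kernelSeries ha).ennreal_ofReal
      (hν.expSummable.measurable_kernelSeries hb).ennreal_ofReal]
    congr 1
    ext y
    rw [lconvolution_def, ← (hc y).2, ofReal_integral_eq_lintegral_ofReal (hc y).1
      (Filter.Eventually.of_forall (hnn y))]
    refine lintegral_congr fun x => ?_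
    rw [ENNReal.ofReal_mul (hμ.nonneg x), neg_add_eq_sub]

theorem HasKernelDensity.measure_Iic {μ : Measure ℝ} {a : ℝ} (ha : 0 < a) {g : PowerSeries ℝ}
    (hμ : HasKernelDensity μ a g) (y : ℝ) : μ.real (Set.Iic y) = kernelSeries (a + 1) g y := by
  have h := kernelSeries_integral_Iic ha hμ.expSummable y
  rw [measureReal_def, hμ.eq_withDensity, withDensity_apply _ measurableSet_Iic,
    ← ofReal_integral_eq_lintegral_ofReal h.1 (Filter.Eventually.of_forall hμ.nonneg), h.2,
    ENNReal.toReal_ofReal]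
  rw [← h.2]
  exact integral_nonneg hμ.nonneg

/-! ### The coefficients of a single noncentral square -/

/-- The numbers `vₗ = (-2)ˡ l! / (2l)! = (-1)ˡ / (1 · 3 ⋯ (2l - 1))`, which turn binomial sums into
Laguerre polynomials of order `-1/2`. -/
noncomputable def halfLaguerreCoeff (l : ℕ) : ℝ :=
  (-2) ^ l * l.factorial / (2 * l).factorial

/-- The polynomial `∑ₗ (k choose l) vₗ tˡ`, a multiple of the Laguerre polynomial of degree `k` and
order `-1/2` at `t / 2`. -/
noncomputable def halfLaguerre (k : ℕ) (t : ℝ) : ℝ :=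
  ∑ l ∈ Finset.range (k + 1), (k.choose l : ℝ) * halfLaguerreCoeff l * t ^ l

theorem halfLaguerreCoeff_succ (l : ℕ) :
    (2 * l + 1) * halfLaguerreCoeff (l + 1) = -halfLaguerreCoeff l := by
  have h : (2 * (l + 1)).factorial = (2 * l + 2) * ((2 * l + 1) * (2 * l).factorial) := by
    rw [show 2 * (l + 1) = 2 * l + 1 + 1 by ring, Nat.factorial_succ, Nat.factorial_succ]
  unfold halfLaguerreCoeff
  rw [h, Nat.factorial_succ, pow_succ]
  push_cast
  field_simp

theorem abs_halfLaguerreCoeff_le_one (l : ℕ) : |halfLaguerreCoeff l| ≤ 1 := by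
  have h : (2 ^ l * l.factorial : ℝ) ≤ (2 * l).factorial := by
    exact_mod_cast Nat.two_pow_mul_factorial_le_factorial_two_mul l
  unfold halfLaguerreCoeff
  rw [abs_div, abs_mul, abs_pow, abs_neg, Nat.abs_cast, Nat.abs_cast, abs_two]
  exact div_le_one_of_le₀ h (by positivity)

theorem abs_halfLaguerre_le (k : ℕ) {t : ℝ} (ht : 0 ≤ t) : |halfLaguerre k t| ≤ (1 + t) ^ k := by
  rw [add_comm, add_pow]
  refine (Finset.abs_sum_le_sum_abs _ _).trans (Finset.sum_le_sum fun l _ => ?_)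
  rw [abs_mul, abs_mul, Nat.abs_cast, abs_of_nonneg (pow_nonneg ht l)]
  calc (k.choose l : ℝ) * |halfLaguerreCoeff l| * t ^ l ≤ k.choose l * 1 * t ^ l := by
        gcongr
        exact abs_halfLaguerreCoeff_le_one l
    _ = _ := by ring

theorem halfLaguerre_eq_sum_range {k N : ℕ} (h : k + 1 ≤ N) (t : ℝ) :
    halfLaguerre k t =
      ∑ l ∈ Finset.range N, (k.choose l : ℝ) * halfLaguerreCoeff l * t ^ l := by
  refine Finset.sum_subset (Finset.range_mono h) fun l _ hl => ?_
  rw [Nat.choose_eq_zero_of_lt (by simpa using hl)]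
  simp

/-- The three-term recurrence of the Laguerre polynomials. -/
theorem halfLaguerre_recurrence (k : ℕ) (t : ℝ) :
    (k + 3 / 2) * halfLaguerre (k + 2) t =
      (2 * k + 5 / 2 - t / 2) * halfLaguerre (k + 1) t - (k + 1) * halfLaguerre k t := by
  -- coefficient of `t ^ (l + 1)`: Pascal's rule together with `(2l + 1) v_{l+1} = -v_l`
  have key : ∀ l ∈ Finset.range (k + 2),
      (k + 3 / 2) * ((k + 2).choose (l + 1) * halfLaguerreCoeff (l + 1) * t ^ (l + 1)) =
      (2 * k + 5 / 2) * ((k + 1).choose (l + 1) * halfLaguerreCoeff (l + 1) * t ^ (l + 1)) -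
      (k + 1) * (k.choose (l + 1) * halfLaguerreCoeff (l + 1) * t ^ (l + 1)) -
      t / 2 * ((k + 1).choose l * halfLaguerreCoeff l * t ^ l) := fun l hl => by
    have hl' : l ≤ k + 1 := Nat.lt_succ_iff.1 (Finset.mem_range.1 hl)
    have h1 : ((k + 2).choose (l + 1) : ℝ) = (k + 1).choose l + (k + 1).choose (l + 1) := by
      exact_mod_cast Nat.choose_succ_succ (k + 1) l
    have h2 : ((k + 1).choose (l + 1) : ℝ) = k.choose l + k.choose (l + 1) := by
      exact_mod_cast Nat.choose_succ_succ k l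
    have h3 : (k.choose l : ℝ) * (k + 1) = (k + 1).choose l * (k + 1 - l) := by
      have := congrArg (Nat.cast (R := ℝ)) (Nat.choose_mul_succ_eq k l)
      push_cast [Nat.cast_sub hl'] at this
      exact this
    have h4 := halfLaguerreCoeff_succ l
    rw [show halfLaguerreCoeff l = -((2 * l + 1) * halfLaguerreCoeff (l + 1)) by linarith, h1, h2,
      pow_succ]
    linear_combination (-halfLaguerreCoeff (l + 1) * t ^ l * t) * h3
  have hsum := Finset.sum_congr rfl key
  rw [Finset.sum_sub_distrib, Finset.sum_sub_distrib, ← Finset.mul_sum, ← Finset.mul_sum,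
    ← Finset.mul_sum, ← Finset.mul_sum, ← halfLaguerre] at hsum
  have split : ∀ j ≤ k + 2, halfLaguerre j t = ∑ l ∈ Finset.range (k + 2),
      (j.choose (l + 1) * halfLaguerreCoeff (l + 1) * t ^ (l + 1)) + halfLaguerreCoeff 0 :=
    fun j hj => by
      rw [halfLaguerre_eq_sum_range (show j + 1 ≤ k + 2 + 1 by omega), Finset.sum_range_succ']
      simp
  rw [split (k + 2) le_rfl, split k (by omega)]
  linear_combination hsum - (2 * (k : ℝ) + 5 / 2) * split (k + 1) (by omega)

/-- The normalised ratio `Γ(k + 1/2) / (√π k!)`, the coefficient of `tᵏ` in `(1 - t) ^ (-1/2)`. -/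
noncomputable def halfGammaRatio (k : ℕ) : ℝ :=
  Real.Gamma (k + 1 / 2) / (√Real.pi * k.factorial)

theorem halfGammaRatio_zero : halfGammaRatio 0 = 1 := by
  have : √Real.pi ≠ 0 := by positivity
  simp only [halfGammaRatio, Nat.cast_zero, zero_add, Real.Gamma_one_half_eq, Nat.factorial_zero,
    Nat.cast_one, mul_one]
  exact div_self this

theorem halfGammaRatio_succ (k : ℕ) :
    (k + 1) * halfGammaRatio (k + 1) = (k + 1 / 2) * halfGammaRatio k := by
  have : √Real.pi ≠ 0 := by positivity
  unfold halfGammaRatio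
  rw [Nat.cast_succ, show (k : ℝ) + 1 + 1 / 2 = (k + 1 / 2) + 1 by ring,
    Real.Gamma_add_one (by positivity), Nat.factorial_succ]
  push_cast
  field_simp

theorem halfGammaRatio_nonneg (k : ℕ) : 0 ≤ halfGammaRatio k := by
  have := Real.Gamma_pos_of_pos (show (0 : ℝ) < k + 1 / 2 by positivity)
  unfold halfGammaRatio
  positivity

theorem halfGammaRatio_le_one (k : ℕ) : halfGammaRatio k ≤ 1 := by
  induction k with
  | zero => exact halfGammaRatio_zero.le
  | succ k ih =>
    have h := halfGammaRatio_succ k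
    have hk : (0 : ℝ) ≤ k := Nat.cast_nonneg k
    nlinarith [halfGammaRatio_nonneg k]

/-- The generating series `e^(-b²/2) (2λ - t)^(-1/2) exp(-(b²/2) t / (2λ - t))` of one summand
`λ (b + Z)²`, given by its explicit coefficients in `t`. -/
noncomputable def squareSeries (lam b : ℝ) : PowerSeries ℝ :=
  PowerSeries.mk fun k => Real.exp (-(1 / 2) * b ^ 2) * (2 * lam) ^ (-(1 / 2) : ℝ) *
    (((2 * lam) ^ k)⁻¹ * (halfGammaRatio k * halfLaguerre k (b ^ 2)))

/-- The series `∑_{k ≥ 1} (1/2) (1 - k b²) (2λ)⁻ᵏ tᵏ`, which is `t` times the logarithmic derivative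
of `squareSeries lam b`. -/
noncomputable def squareLogDeriv (lam b : ℝ) : PowerSeries ℝ :=
  PowerSeries.mk fun k => if k = 0 then 0 else (1 / 2) * ((1 - k * b ^ 2) * ((2 * lam) ^ k)⁻¹)

theorem expSummable_squareSeries {lam : ℝ} (hlam : 0 < lam) (b : ℝ) :
    ExpSummable (squareSeries lam b) := by
  intro r hr
  have hK : 0 ≤ Real.exp (-(1 / 2) * b ^ 2) * (2 * lam) ^ (-(1 / 2) : ℝ) := by positivity
  refine Summable.of_nonneg_of_le (fun k => by positivity) (fun k => ?_)
    ((Real.summable_pow_div_factorial ((2 * lam)⁻¹ * (1 + b ^ 2) * r)).mul_left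
      (Real.exp (-(1 / 2) * b ^ 2) * (2 * lam) ^ (-(1 / 2) : ℝ)))
  rw [squareSeries, PowerSeries.coeff_mk, abs_mul, abs_of_nonneg hK, abs_mul, abs_mul,
    abs_of_nonneg (halfGammaRatio_nonneg k),
    abs_of_nonneg (show 0 ≤ ((2 * lam) ^ k)⁻¹ by positivity)]
  calc _ ≤ Real.exp (-(1 / 2) * b ^ 2) * (2 * lam) ^ (-(1 / 2) : ℝ) *
        (((2 * lam) ^ k)⁻¹ * (1 * (1 + b ^ 2) ^ k)) * (r ^ k / k.factorial) := by
        gcongr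
        · exact halfGammaRatio_le_one k
        · exact abs_halfLaguerre_le k (sq_nonneg b)
    _ = _ := by
        rw [mul_pow ((2 * lam)⁻¹ * (1 + b ^ 2)), mul_pow (2 * lam)⁻¹, inv_pow]
        ring

theorem ExpSummable.rescale_neg_one {g : PowerSeries ℝ} (hg : ExpSummable g) :
    ExpSummable (PowerSeries.rescale (-1) g) := by
  intro r hr
  refine (hg r hr).congr fun k => ?_
  rw [PowerSeries.coeff_rescale, abs_mul, abs_pow, abs_neg, abs_one, one_pow, one_mul]

/-! ### The logarithmic derivative and the coefficient recursion -/

/-- `D` is the rational function `((1/2)(1 - a t) - b²/2) a t / (1 - a t)²` with `a = 1 / (2λ)`; here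
the denominator is cleared. -/
theorem squareLogDeriv_mul_sq (lam b : ℝ) :
    (1 - PowerSeries.C (2 * lam)⁻¹ * PowerSeries.X) ^ 2 * squareLogDeriv lam b =
      PowerSeries.C ((1 / 2 - b ^ 2 / 2) * (2 * lam)⁻¹) * PowerSeries.X -
        PowerSeries.C (1 / 2 * ((2 * lam)⁻¹) ^ 2) * PowerSeries.X ^ 2 := by
  set a := (2 * lam)⁻¹ with ha
  have e : (1 - PowerSeries.C a * PowerSeries.X) ^ 2 * squareLogDeriv lam b =
      squareLogDeriv lam b - PowerSeries.C (2 * a) * (PowerSeries.X * squareLogDeriv lam b) +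
        PowerSeries.C (a ^ 2) * (PowerSeries.X ^ 2 * squareLogDeriv lam b) := by
    rw [map_mul, map_pow, map_ofNat]
    ring
  rw [e]
  ext k
  rw [map_add, map_sub, map_sub, PowerSeries.coeff_C_mul, PowerSeries.coeff_C_mul,
    PowerSeries.coeff_C_mul, PowerSeries.coeff_C_mul]
  rcases k with _ | _ | k
  · simp [squareLogDeriv, PowerSeries.coeff_X_pow_mul', PowerSeries.coeff_X_pow]
  · simp [squareLogDeriv, PowerSeries.coeff_X_pow_mul', PowerSeries.coeff_X_pow, ← inv_pow,
      PowerSeries.coeff_succ_X_mul, ← ha]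
    ring
  · rw [PowerSeries.coeff_X_pow_mul', PowerSeries.coeff_X_pow, PowerSeries.coeff_X,
      PowerSeries.coeff_succ_X_mul]
    rcases k with _ | k
    · simp [squareLogDeriv, ← inv_pow, ← ha]
      ring
    · simp [squareLogDeriv, ← inv_pow, ← ha]
      ring

theorem coeff_squareSeries_one (lam b : ℝ) :
    PowerSeries.coeff 1 (squareSeries lam b) =
      (1 / 2 - b ^ 2 / 2) * (2 * lam)⁻¹ * PowerSeries.coeff 0 (squareSeries lam b) := by
  have h := halfGammaRatio_succ 0
  rw [halfGammaRatio_zero] at h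
  norm_num at h
  simp only [squareSeries, PowerSeries.coeff_mk, h, halfGammaRatio_zero, halfLaguerre,
    Finset.sum_range_succ, Finset.sum_range_zero, halfLaguerreCoeff]
  norm_num [Nat.factorial]
  ring

/-- The Laguerre recurrence after rescaling by powers of `2λ` and multiplication by the coefficients
of `(1 - t) ^ (-1/2)`. -/
theorem coeff_squareSeries_recurrence (lam b : ℝ) (k : ℕ) :
    (k + 2) * PowerSeries.coeff (k + 2) (squareSeries lam b) =
      (2 * k + 5 / 2 - b ^ 2 / 2) * (2 * lam)⁻¹ * PowerSeries.coeff (k + 1) (squareSeries lam b) -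
        (k + 1 / 2) * ((2 * lam)⁻¹) ^ 2 * PowerSeries.coeff k (squareSeries lam b) := by
  have h1 := halfGammaRatio_succ k
  have h2 := halfGammaRatio_succ (k + 1)
  have h3 := halfLaguerre_recurrence k (b ^ 2)
  push_cast at h2
  simp only [squareSeries, PowerSeries.coeff_mk, ← inv_pow]
  set K := Real.exp (-(1 / 2) * b ^ 2) * (2 * lam) ^ (-(1 / 2) : ℝ)
  set a := (2 * lam)⁻¹
  linear_combination (K * a ^ (k + 2) * halfLaguerre (k + 2) (b ^ 2)) * h2 +
    (K * a ^ (k + 2) * halfGammaRatio (k + 1)) * h3 -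
    (K * a ^ (k + 2) * halfLaguerre k (b ^ 2)) * h1

theorem sq_mul_X_mul_derivative_squareSeries (lam b : ℝ) :
    (1 - PowerSeries.C (2 * lam)⁻¹ * PowerSeries.X) ^ 2 *
        (PowerSeries.X * PowerSeries.derivative ℝ (squareSeries lam b)) =
      (PowerSeries.C ((1 / 2 - b ^ 2 / 2) * (2 * lam)⁻¹) * PowerSeries.X -
        PowerSeries.C (1 / 2 * ((2 * lam)⁻¹) ^ 2) * PowerSeries.X ^ 2) *
          squareSeries lam b := by
  set a := (2 * lam)⁻¹ with ha
  set f := squareSeries lam b with hf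
  have e : (1 - PowerSeries.C a * PowerSeries.X) ^ 2 *
        (PowerSeries.X * PowerSeries.derivative ℝ f) =
      PowerSeries.X * PowerSeries.derivative ℝ f -
        PowerSeries.C (2 * a) * (PowerSeries.X * (PowerSeries.X * PowerSeries.derivative ℝ f)) +
        PowerSeries.C (a ^ 2) *
          (PowerSeries.X * (PowerSeries.X * (PowerSeries.X * PowerSeries.derivative ℝ f))) := by
    rw [map_mul, map_pow, map_ofNat]
    ring
  have e' : (PowerSeries.C ((1 / 2 - b ^ 2 / 2) * a) * PowerSeries.X -
        PowerSeries.C (1 / 2 * a ^ 2) * PowerSeries.X ^ 2) * f =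
      PowerSeries.C ((1 / 2 - b ^ 2 / 2) * a) * (PowerSeries.X * f) -
        PowerSeries.C (1 / 2 * a ^ 2) * (PowerSeries.X * (PowerSeries.X * f)) := by
    ring
  rw [e, e']
  ext k
  rw [map_add, map_sub, map_sub, PowerSeries.coeff_C_mul, PowerSeries.coeff_C_mul,
    PowerSeries.coeff_C_mul, PowerSeries.coeff_C_mul]
  rcases k with _ | _ | k
  · simp
  · simp only [PowerSeries.coeff_succ_X_mul, PowerSeries.coeff_derivative, zero_add,
      PowerSeries.coeff_zero_X_mul]
    have h := coeff_squareSeries_one lam b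
    rw [← hf, ← ha] at h
    push_cast
    linear_combination h
  · have h := coeff_squareSeries_recurrence lam b k
    rw [← hf, ← ha] at h
    rcases k with _ | k
    · simp only [PowerSeries.coeff_succ_X_mul, PowerSeries.coeff_derivative, zero_add,
        PowerSeries.coeff_zero_X_mul] at h ⊢
      push_cast at h ⊢
      linear_combination h
    · simp only [PowerSeries.coeff_succ_X_mul, PowerSeries.coeff_derivative] at h ⊢
      push_cast at h ⊢
      linear_combination h

/-- The differential equation `t f' = D f` of the generating series of one summand. Multiplied by
`(1 - t / (2λ))²` it is the three-term recurrence of the Laguerre polynomials. -/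
theorem X_mul_derivative_squareSeries (lam b : ℝ) :
    PowerSeries.X * PowerSeries.derivative ℝ (squareSeries lam b) =
      squareLogDeriv lam b * squareSeries lam b := by
  have hne : (1 - PowerSeries.C (2 * lam)⁻¹ * PowerSeries.X : PowerSeries ℝ) ^ 2 ≠ 0 := by
    refine pow_ne_zero 2 fun h => ?_
    have := congrArg PowerSeries.constantCoeff h
    simp at this
  refine mul_left_cancel₀ hne ?_
  rw [sq_mul_X_mul_derivative_squareSeries, ← mul_assoc, squareLogDeriv_mul_sq]

theorem X_mul_derivative_prod {ι : Type*} (s : Finset ι) (lam b : ι → ℝ) :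
    PowerSeries.X * PowerSeries.derivative ℝ (∏ i ∈ s, squareSeries (lam i) (b i)) =
      (∑ i ∈ s, squareLogDeriv (lam i) (b i)) * ∏ i ∈ s, squareSeries (lam i) (b i) := by
  classical
  induction s using Finset.induction_on with
  | empty => simp
  | insert i s hi ih =>
    rw [Finset.prod_insert hi, Finset.sum_insert hi, Derivation.leibniz, smul_eq_mul, smul_eq_mul]
    linear_combination (squareSeries (lam i) (b i)) * ih +
      (∏ i ∈ s, squareSeries (lam i) (b i)) * X_mul_derivative_squareSeries (lam i) (b i)

/-- The recursively defined coefficients are those of the product of the generating series of the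
summands: both solve `t f' = D f` with the same constant term. -/
theorem coeff_prod_squareSeries {n : ℕ} (lam b : Fin n → ℝ) (k : ℕ) :
    PowerSeries.coeff k (∏ i, squareSeries (lam i) (b i)) = cCoeff lam b k := by
  induction k using Nat.strong_induction_on with
  | _ k ih =>
    rcases Nat.eq_zero_or_pos k with rfl | hk
    · rw [cCoeff_zero, PowerSeries.coeff_zero_eq_constantCoeff_apply, map_prod, Finset.mul_sum,
        Real.exp_sum, ← Finset.prod_mul_distrib]
      refine Finset.prod_congr rfl fun i _ => ?_
      rw [← PowerSeries.coeff_zero_eq_constantCoeff_apply, squareSeries, PowerSeries.coeff_mk,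
        halfGammaRatio_zero]
      simp [halfLaguerre, halfLaguerreCoeff]
    · have h := congrArg (PowerSeries.coeff k) (X_mul_derivative_prod Finset.univ lam b)
      have hk0 : (k : ℝ) ≠ 0 := by positivity
      have hl : PowerSeries.coeff k (PowerSeries.X *
          PowerSeries.derivative ℝ (∏ i, squareSeries (lam i) (b i))) =
          k * PowerSeries.coeff k (∏ i, squareSeries (lam i) (b i)) := by
        obtain ⟨m, rfl⟩ : ∃ m, k = m + 1 := ⟨k - 1, by omega⟩
        rw [PowerSeries.coeff_succ_X_mul, PowerSeries.coeff_derivative]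
        push_cast
        ring
      rw [hl, mul_comm (∑ i, _), PowerSeries.coeff_mul,
        Finset.Nat.sum_antidiagonal_eq_sum_range_succ (fun i j =>
          PowerSeries.coeff i (∏ i, squareSeries (lam i) (b i)) *
          PowerSeries.coeff j (∑ i, squareLogDeriv (lam i) (b i))), Finset.sum_range_succ] at h
      -- `D` has no constant term, so the recursion only involves `c_j` with `j < k`
      have h0 : PowerSeries.coeff (k - k) (∑ i, squareLogDeriv (lam i) (b i)) = 0 := by
        rw [map_sum, Nat.sub_self]
        simp [squareLogDeriv]
      rw [h0, mul_zero, add_zero] at h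
      rw [cCoeff_of_pos lam b hk, eq_comm, one_div, inv_mul_eq_iff_eq_mul₀ hk0, h]
      refine Finset.sum_congr rfl fun j hj => ?_
      have hj' := Finset.mem_range.1 hj
      rw [ih j hj', mul_comm]
      congr 1
      rw [map_sum, dCoeff, Finset.mul_sum]
      refine Finset.sum_congr rfl fun i _ => ?_
      rw [squareLogDeriv, PowerSeries.coeff_mk, if_neg (by omega)]

/-! ### The law of a single noncentral square -/

/-- The kernel series of one summand in closed form: the Laguerre polynomials are the Cauchy product
of the series of `exp (-y / (2λ))` and of `cosh (b √(y / λ))`. -/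
theorem kernelSeries_squareSeries {lam : ℝ} (hlam : 0 < lam) (b : ℝ) {y : ℝ} (hy : 0 < y) :
    kernelSeries (1 / 2) (PowerSeries.rescale (-1) (squareSeries lam b)) y =
      Real.exp (-(1 / 2) * b ^ 2) * (2 * lam) ^ (-(1 / 2) : ℝ) * y ^ (-(1 / 2) : ℝ) / √Real.pi *
        (Real.cosh (b * √(y / lam)) * Real.exp (-y / (2 * lam))) := by
  have hc := Real.hasSum_cosh (b * √(y / lam))
  have he := Real.summable_pow_div_factorial (-y / (2 * lam))
  have hexp : Real.exp (-y / (2 * lam)) = ∑' n : ℕ, (-y / (2 * lam)) ^ n / n.factorial := by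
    rw [Real.exp_eq_exp_ℝ, NormedSpace.exp_eq_tsum_div]
  rw [← hc.tsum_eq, hexp, tsum_mul_tsum_eq_tsum_sum_antidiagonal_of_summable_norm hc.summable.norm
    he.norm, ← tsum_mul_left, kernelSeries]
  refine tsum_congr fun k => ?_
  rw [Finset.Nat.sum_antidiagonal_eq_sum_range_succ (fun i j =>
    (b * √(y / lam)) ^ (2 * i) / ((2 * i).factorial : ℝ) * ((-y / (2 * lam)) ^ j / j.factorial)),
    PowerSeries.coeff_rescale, squareSeries, PowerSeries.coeff_mk, powerKernel_of_pos _ hy,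
    show (1 / 2 : ℝ) + k - 1 = -(1 / 2) + k by ring, Real.rpow_add hy, Real.rpow_natCast,
    add_comm (1 / 2 : ℝ) k, halfGammaRatio, halfLaguerre]
  have hG := (Real.Gamma_pos_of_pos (show (0 : ℝ) < k + 1 / 2 by positivity)).ne'
  have hpi : √Real.pi ≠ 0 := by positivity
  have hk : (k.factorial : ℝ) ≠ 0 := by positivity
  have hsum : ∑ i ∈ Finset.range k.succ, (b * √(y / lam)) ^ (2 * i) / ((2 * i).factorial : ℝ) *
      ((-y / (2 * lam)) ^ (k - i) / (k - i).factorial) =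
      (-y / (2 * lam)) ^ k / k.factorial *
        ∑ l ∈ Finset.range (k + 1), (k.choose l : ℝ) * halfLaguerreCoeff l * (b ^ 2) ^ l := by
    rw [Finset.mul_sum]
    refine Finset.sum_congr rfl fun l hl => ?_
    have hl' : l ≤ k := Nat.lt_succ_iff.1 (Finset.mem_range.1 hl)
    obtain ⟨j, rfl⟩ := Nat.exists_eq_add_of_le hl'
    have hch : ((l + j).choose l : ℝ) = (l + j).factorial / (l.factorial * j.factorial) :=
      Nat.cast_add_choose ℝ
    rw [hch, pow_mul, mul_pow, Real.sq_sqrt (by positivity), Nat.add_sub_cancel_left, pow_add,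
      halfLaguerreCoeff, mul_pow]
    have h1 : (y / lam) ^ l = (-y / (2 * lam)) ^ l * (-2) ^ l := by
      rw [← mul_pow]
      congr 1
      field_simp
    rw [h1]
    field_simp
  rw [hsum]
  have h2 : (-y / (2 * lam)) ^ k = (-1) ^ k * y ^ k * ((2 * lam) ^ k)⁻¹ := by
    rw [← inv_pow, ← mul_pow, ← mul_pow]
    congr 1
    ring
  rw [h2]
  field_simp

theorem kernelSeries_squareSeries_nonneg {lam : ℝ} (hlam : 0 < lam) (b y : ℝ) :
    0 ≤ kernelSeries (1 / 2) (PowerSeries.rescale (-1) (squareSeries lam b)) y := by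
  rcases le_or_gt y 0 with hy | hy
  · rw [kernelSeries_of_nonpos _ _ hy]
  · rw [kernelSeries_squareSeries hlam b hy]
    have := Real.cosh_pos (b * √(y / lam))
    positivity

/-- The change of variables `y = λ x²` turns the kernel series into the sum of the two Gaussian
densities at `x` and `-x`. -/
theorem two_mul_kernelSeries_squareSeries {lam : ℝ} (hlam : 0 < lam) (b : ℝ) {x : ℝ}
    (hx : 0 < x) :
    2 * lam * x * kernelSeries (1 / 2) (PowerSeries.rescale (-1) (squareSeries lam b))
        (lam * x ^ 2) =
      ProbabilityTheory.gaussianPDFReal b 1 x + ProbabilityTheory.gaussianPDFReal b 1 (-x) := by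
  rw [kernelSeries_squareSeries hlam b (by positivity), mul_div_cancel_left₀ _ hlam.ne',
    Real.sqrt_sq hx.le, Real.cosh_eq, ProbabilityTheory.gaussianPDFReal,
    ProbabilityTheory.gaussianPDFReal]
  have h1 : -(lam * x ^ 2) / (2 * lam) = -x ^ 2 / 2 := by field_simp
  have h2 : (2 * lam) ^ (-(1 / 2) : ℝ) * (lam * x ^ 2) ^ (-(1 / 2) : ℝ) =
      (√2 * lam * x)⁻¹ := by
    rw [← Real.mul_rpow (by positivity) (by positivity), Real.rpow_neg (by positivity),
      ← Real.sqrt_eq_rpow, show 2 * lam * (lam * x ^ 2) = 2 * (lam * x) ^ 2 by ring,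
      Real.sqrt_mul (by norm_num), Real.sqrt_sq (by positivity), mul_assoc]
  have h3 : √(2 * Real.pi * ((1 : NNReal) : ℝ)) = √2 * √Real.pi := by
    rw [NNReal.coe_one, mul_one, Real.sqrt_mul (by norm_num)]
  have h4 : Real.exp (-(x - b) ^ 2 / (2 * ((1 : NNReal) : ℝ))) =
      Real.exp (-(1 / 2) * b ^ 2) * Real.exp (b * x) * Real.exp (-x ^ 2 / 2) := by
    rw [← Real.exp_add, ← Real.exp_add, NNReal.coe_one]
    ring_nf
  have h5 : Real.exp (-(-x - b) ^ 2 / (2 * ((1 : NNReal) : ℝ))) =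
      Real.exp (-(1 / 2) * b ^ 2) * Real.exp (-(b * x)) * Real.exp (-x ^ 2 / 2) := by
    rw [← Real.exp_add, ← Real.exp_add, NNReal.coe_one]
    ring_nf
  rw [h1, h3, h4, h5, mul_assoc (Real.exp (-(1 / 2) * b ^ 2)), h2]
  have : √Real.pi ≠ 0 := by positivity
  have : √(2 : ℝ) ≠ 0 := by positivity
  field_simp

theorem lintegral_eq_setLIntegral_Ioi_add_neg (f : ℝ → ENNReal) (hf : Measurable f) :
    ∫⁻ x, f x = ∫⁻ x in Set.Ioi 0, (f x + f (-x)) := by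
  rw [lintegral_add_left hf, ← lintegral_add_compl f (measurableSet_Ioi (a := (0 : ℝ)))]
  congr 1
  rw [Set.compl_Ioi, ← setLIntegral_congr (Iio_ae_eq_Iic (a := (0 : ℝ))),
    ← (Measure.measurePreserving_neg (volume : Measure ℝ)).setLIntegral_comp_preimage
      measurableSet_Iio hf]
  simp

theorem image_mul_sq_Ioi {lam : ℝ} (hlam : 0 < lam) :
    (fun x : ℝ => lam * x ^ 2) '' Set.Ioi 0 = Set.Ioi 0 := by
  ext y
  constructor
  · rintro ⟨x, hx, rfl⟩
    have : 0 < x := hx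
    exact Set.mem_Ioi.2 (by positivity)
  · intro hy
    have hy' : 0 < y := hy
    refine ⟨√(y / lam), Set.mem_Ioi.2 (by positivity), ?_⟩
    simp only
    rw [Real.sq_sqrt (by positivity)]
    field_simp

/-- The law of `λ x²` with `x` Gaussian of mean `b` and variance one: fold the line onto the positive
half-line and substitute `y = λ x²`. -/
theorem hasKernelDensity_map_mul_sq {lam : ℝ} (hlam : 0 < lam) (b : ℝ) :
    HasKernelDensity ((ProbabilityTheory.gaussianReal b 1).map fun x => lam * x ^ 2) (1 / 2)
      (PowerSeries.rescale (-1) (squareSeries lam b)) := by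
  have hE := (expSummable_squareSeries hlam b).rescale_neg_one
  have hnn := kernelSeries_squareSeries_nonneg hlam b
  refine ⟨hE, hnn, ?_⟩
  have hm : Measurable fun x : ℝ => lam * x ^ 2 := by fun_prop
  set p := kernelSeries (1 / 2) (PowerSeries.rescale (-1) (squareSeries lam b)) with hp
  have hpm : Measurable p := hE.measurable_kernelSeries (by norm_num)
  refine Measure.ext_of_lintegral _ fun f hf => ?_
  have hg : Measurable (ProbabilityTheory.gaussianPDF b 1) :=
    ProbabilityTheory.measurable_gaussianPDF b 1
  rw [lintegral_map hf hm, ProbabilityTheory.gaussianReal_of_var_ne_zero _ one_ne_zero,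
    show (fun x => f (lam * x ^ 2)) = f ∘ fun x => lam * x ^ 2 from rfl,
    lintegral_withDensity_eq_lintegral_mul _ hg (hf.comp hm),
    lintegral_withDensity_eq_lintegral_mul _ hpm.ennreal_ofReal hf]
  rw [lintegral_eq_setLIntegral_Ioi_add_neg _ (hg.mul (hf.comp hm))]
  have hsupp : ∫⁻ y, ((fun y => ENNReal.ofReal (p y)) * f) y =
      ∫⁻ y in Set.Ioi 0, ((fun y => ENNReal.ofReal (p y)) * f) y := by
    rw [← lintegral_indicator measurableSet_Ioi]
    refine lintegral_congr fun y => ?_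
    by_cases hy : y ∈ Set.Ioi (0 : ℝ)
    · rw [Set.indicator_of_mem hy]
    · rw [Set.indicator_of_notMem hy, Pi.mul_apply, hp,
        kernelSeries_of_nonpos _ _ (le_of_not_gt fun h : 0 < y => hy h), ENNReal.ofReal_zero,
        zero_mul]
  have hinj : Set.InjOn (fun x : ℝ => lam * x ^ 2) (Set.Ioi 0) := by
    intro x hx x' hx' h
    have hx1 : 0 < x := hx
    have hx2 : 0 < x' := hx'
    have h' : x ^ 2 = x' ^ 2 := mul_left_cancel₀ hlam.ne' h
    exact (pow_left_inj₀ hx1.le hx2.le two_ne_zero).1 h'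
  have himage := image_mul_sq_Ioi hlam
  rw [hsupp]
  nth_rewrite 2 [← himage]
  rw [lintegral_image_eq_lintegral_abs_deriv_mul
    (measurableSet_Ioi (a := (0 : ℝ))) (f' := fun x => 2 * lam * x) (fun x _ => ?_) hinj]
  · refine setLIntegral_congr_fun measurableSet_Ioi fun x hx => ?_
    have hx' : 0 < x := hx
    simp only [Pi.mul_apply, Function.comp_apply, neg_sq]
    rw [← add_mul, ← mul_assoc, ← ENNReal.ofReal_mul (abs_nonneg _),
      abs_of_pos (by positivity), hp, two_mul_kernelSeries_squareSeries hlam b hx',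
      ENNReal.ofReal_add (ProbabilityTheory.gaussianPDFReal_nonneg _ _ _)
        (ProbabilityTheory.gaussianPDFReal_nonneg _ _ _)]
    rfl
  · have := ((hasDerivAt_pow 2 x).const_mul lam).hasDerivWithinAt (s := Set.Ioi 0)
    refine this.congr_deriv ?_
    push_cast
    ring

/-! ### Sums of independent noncentral squares -/

theorem hasKernelDensity_map_mul_add_sq {lam : ℝ} (hlam : 0 < lam) (b : ℝ) :
    HasKernelDensity ((ProbabilityTheory.gaussianReal 0 1).map fun z => lam * (b + z) ^ 2) (1 / 2)
      (PowerSeries.rescale (-1) (squareSeries lam b)) := by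
  have h := hasKernelDensity_map_mul_sq hlam b
  have e : ProbabilityTheory.gaussianReal b 1 =
      (ProbabilityTheory.gaussianReal 0 1).map fun z => b + z := by
    rw [ProbabilityTheory.gaussianReal_map_const_add, zero_add]
  rw [e, Measure.map_map (by fun_prop) (by fun_prop)] at h
  exact h

/-- The induction runs over nonempty sets of coordinates, since the empty sum has no density. -/
theorem hasKernelDensity_map_sum_mul_add_sq {n : ℕ} (hn : 1 ≤ n) {lam : Fin n → ℝ}
    (hlam : ∀ i, 0 < lam i) (b : Fin n → ℝ) :
    HasKernelDensity
      ((Measure.pi fun _ : Fin n => ProbabilityTheory.gaussianReal 0 1).map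
        fun z => ∑ i, lam i * (b i + z i) ^ 2)
      (n / 2) (PowerSeries.rescale (-1) (∏ i, squareSeries (lam i) (b i))) := by
  set ν := Measure.pi fun _ : Fin n => ProbabilityTheory.gaussianReal 0 1
  let Y : Fin n → (Fin n → ℝ) → ℝ := fun i z => lam i * (b i + z i) ^ 2
  have hY : ∀ i, Measurable (Y i) := fun i => by fun_prop
  have hind : ProbabilityTheory.iIndepFun Y ν :=
    ProbabilityTheory.iIndepFun_pi (X := fun i (x : ℝ) => lam i * (b i + x) ^ 2)
      fun i => by fun_prop
  have hone : ∀ i, HasKernelDensity (ν.map (Y i)) (1 / 2)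
      (PowerSeries.rescale (-1) (squareSeries (lam i) (b i))) := fun i => by
    have e : ν.map (Y i) = (ProbabilityTheory.gaussianReal 0 1).map
        fun z => lam i * (b i + z) ^ 2 := by
      rw [← (measurePreserving_eval (fun _ : Fin n => ProbabilityTheory.gaussianReal 0 1) i).map_eq]
      exact (Measure.map_map (g := fun z => lam i * (b i + z) ^ 2) (by fun_prop)
        (measurable_pi_apply i)).symm
    rw [e]
    exact hasKernelDensity_map_mul_add_sq (hlam i) (b i)
  have key : ∀ s : Finset (Fin n), s.Nonempty → HasKernelDensity (ν.map (∑ i ∈ s, Y i))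
      (s.card / 2) (PowerSeries.rescale (-1) (∏ i ∈ s, squareSeries (lam i) (b i))) := by
    intro s hs
    induction hs using Finset.Nonempty.cons_induction with
    | singleton i => simpa using hone i
    | cons i s hi hs ih =>
      have hcard : (0 : ℝ) < s.card / 2 := by
        have := hs.card_pos
        positivity
      have h := ih.conv hcard (by norm_num : (0 : ℝ) < 1 / 2) (hone i)
      rw [← (hind.indepFun_finsetSum_of_notMem hY hi).map_add_eq_map_conv_map
        (by fun_prop) (hY i), ← map_mul] at h
      rw [Finset.sum_cons, Finset.prod_cons, Finset.card_cons, add_comm (Y i), mul_comm]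
      convert h using 1
      push_cast
      ring
  have h := key Finset.univ ⟨⟨0, hn⟩, Finset.mem_univ _⟩
  rw [Finset.card_univ, Fintype.card_fin] at h
  convert h using 2
  ext z
  simp [Y]

/-! ### Reduction of the quadratic form to principal axes -/

theorem quadForm_eq_dotProduct {n : ℕ} (A : Matrix (Fin n) (Fin n) ℝ)
    (x : EuclideanSpace ℝ (Fin n)) :
    quadForm A x = x.ofLp ⬝ᵥ A.mulVec x.ofLp := by
  simp only [quadForm, dotProduct, Matrix.mulVec, Finset.mul_sum]
  exact Finset.sum_congr rfl fun i _ => Finset.sum_congr rfl fun j _ => by ring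

theorem isUnit_det_sqrt {n : ℕ} {S : Matrix (Fin n) (Fin n) ℝ} (hS : S.PosDef) :
    IsUnit (CFC.sqrt S).det := by
  have h : CFC.sqrt S * CFC.sqrt S = S := CFC.sqrt_mul_sqrt_self S hS.posSemidef.nonneg
  have hd : S.det ≠ 0 := hS.det_pos.ne'
  rw [← h, Matrix.det_mul] at hd
  exact isUnit_iff_ne_zero.2 (left_ne_zero_of_mul hd)

theorem transpose_sqrt {n : ℕ} (S : Matrix (Fin n) (Fin n) ℝ) :
    (CFC.sqrt S).transpose = CFC.sqrt S := by
  have h := (CFC.sqrt_nonneg S).isSelfAdjoint.star_eq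
  rwa [Matrix.star_eq_conjTranspose, Matrix.conjTranspose_eq_transpose_of_trivial] at h

/-- `diag lam` is congruent to the positive definite matrix `A`. -/
theorem IsParam.lam_pos {n : ℕ} {A S : Matrix (Fin n) (Fin n) ℝ} (hA : A.PosDef)
    (hS : S.PosDef) {mu : EuclideanSpace ℝ (Fin n)} {P : Matrix (Fin n) (Fin n) ℝ}
    {lam b : Fin n → ℝ} (h : IsParam A S mu P lam b) (i : Fin n) : 0 < lam i := by
  have hP : P.transpose * P = 1 := (Matrix.mem_orthogonalGroup_iff' _ _).1 h.orthogonal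
  have hPu : IsUnit P := IsUnit.of_mul_eq_one_right _ hP
  have hSu : IsUnit (CFC.sqrt S) := (Matrix.isUnit_iff_isUnit_det _).2 (isUnit_det_sqrt hS)
  have hpd : (Matrix.diagonal lam).PosDef := by
    rw [← h.diagonalizes]
    have := (Matrix.IsUnit.posDef_star_left_conjugate_iff (x := A) (hSu.mul hPu)).2 hA
    rw [star_mul, Matrix.star_eq_conjTranspose, Matrix.star_eq_conjTranspose,
      Matrix.conjTranspose_eq_transpose_of_trivial, Matrix.conjTranspose_eq_transpose_of_trivial,
      transpose_sqrt] at this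
    simpa only [mul_assoc] using this
  exact Matrix.posDef_diagonal_iff.1 hpd i

/-- In the coordinates `x = mu + S^{1/2} P z` the quadratic form is diagonal. -/
theorem IsParam.quadForm_eq {n : ℕ} {A S : Matrix (Fin n) (Fin n) ℝ}
    (hS : S.PosDef) {mu : EuclideanSpace ℝ (Fin n)} {P : Matrix (Fin n) (Fin n) ℝ}
    {lam b : Fin n → ℝ} (h : IsParam A S mu P lam b) (z : Fin n → ℝ) :
    quadForm A (WithLp.toLp 2 (mu.ofLp + (CFC.sqrt S).mulVec (P.mulVec z))) =
      ∑ i, lam i * (b i + z i) ^ 2 := by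
  have hP : P * P.transpose = 1 := (Matrix.mem_orthogonalGroup_iff _ _).1 h.orthogonal
  have hmu : mu.ofLp = (CFC.sqrt S).mulVec (P.mulVec b) := by
    rw [h.shift, Matrix.mulVec_mulVec _ P, hP, Matrix.one_mulVec, Matrix.mulVec_mulVec,
      Matrix.mul_nonsing_inv _ (isUnit_det_sqrt hS), Matrix.one_mulVec]
  rw [quadForm_eq_dotProduct]
  simp only
  rw [hmu, ← Matrix.mulVec_add, ← Matrix.mulVec_add, Matrix.mulVec_mulVec]
  have e : ((CFC.sqrt S * P).mulVec (b + z)) ⬝ᵥ (A.mulVec ((CFC.sqrt S * P).mulVec (b + z))) =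
      (b + z) ⬝ᵥ ((Matrix.diagonal lam).mulVec (b + z)) := by
    rw [← h.diagonalizes, Matrix.mulVec_mulVec, Matrix.dotProduct_mulVec, Matrix.vecMul_mulVec,
      ← Matrix.dotProduct_mulVec, Matrix.transpose_mul, transpose_sqrt]
    simp only [mul_assoc]
  rw [e]
  simp only [dotProduct, Matrix.mulVec_diagonal, Pi.add_apply]
  exact Finset.sum_congr rfl fun i _ => by ring

/-- The standard Gaussian measure is invariant under orthogonal matrices. -/
theorem map_mulVec_pi_gaussianReal {n : ℕ} {P : Matrix (Fin n) (Fin n) ℝ}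
    (hP : P ∈ Matrix.orthogonalGroup (Fin n) ℝ) :
    (Measure.pi fun _ : Fin n => ProbabilityTheory.gaussianReal 0 1).map
        (fun z => WithLp.toLp 2 (P.mulVec z)) =
      ProbabilityTheory.stdGaussian (EuclideanSpace ℝ (Fin n)) := by
  have hP' : P.transpose * P = 1 := (Matrix.mem_orthogonalGroup_iff' _ _).1 hP
  let f : EuclideanSpace ℝ (Fin n) →ₗᵢ[ℝ] EuclideanSpace ℝ (Fin n) :=
    { toLinearMap := Matrix.toEuclideanLin P
      norm_map' := fun x => by
        rw [← sq_eq_sq₀ (norm_nonneg _) (norm_nonneg _), ← real_inner_self_eq_norm_sq,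
          ← real_inner_self_eq_norm_sq, EuclideanSpace.inner_eq_star_dotProduct,
          EuclideanSpace.inner_eq_star_dotProduct, star_trivial, star_trivial,
          Matrix.toLpLin_apply, Matrix.dotProduct_mulVec, Matrix.vecMul_mulVec, hP',
          Matrix.vecMul_one] }
  have h := ProbabilityTheory.stdGaussian_map (f.toLinearIsometryEquiv rfl)
  rw [← ProbabilityTheory.map_pi_eq_stdGaussian, Measure.map_map
    (f.toLinearIsometryEquiv rfl).continuous.measurable (by fun_prop)] at h
  rw [← ProbabilityTheory.map_pi_eq_stdGaussian, ← h]
  rfl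

theorem map_quadForm_eq {n : ℕ} {A S : Matrix (Fin n) (Fin n) ℝ}
    (hS : S.PosDef) {mu : EuclideanSpace ℝ (Fin n)} {P : Matrix (Fin n) (Fin n) ℝ}
    {lam b : Fin n → ℝ} (h : IsParam A S mu P lam b) :
    (ProbabilityTheory.multivariateGaussian mu S).map (quadForm A) =
      (Measure.pi fun _ : Fin n => ProbabilityTheory.gaussianReal 0 1).map
        fun z => ∑ i, lam i * (b i + z i) ^ 2 := by
  have hq : Measurable (quadForm A) := by
    unfold quadForm
    fun_prop
  have hPm : Measurable fun z : Fin n → ℝ => WithLp.toLp 2 (P.mulVec z) := by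
    fun_prop
  rw [ProbabilityTheory.multivariateGaussian, ← map_mulVec_pi_gaussianReal h.orthogonal,
    Measure.map_map (by fun_prop) hPm, Measure.map_map hq (by fun_prop)]
  congr 1
  ext z
  rw [← h.quadForm_eq hS]
  rfl

end QuadFormSeries

/-! ### Distribution function and density of the quadratic form -/

theorem mainTheorem1 {n : ℕ} (hn : 1 ≤ n)
    (A S : Matrix (Fin n) (Fin n) ℝ) (hA : A.PosDef) (hS : S.PosDef)
    (mu : EuclideanSpace ℝ (Fin n))
    {Ω : Type*} [MeasurableSpace Ω] (Pr : MeasureTheory.Measure Ω)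
    (X : Ω → EuclideanSpace ℝ (Fin n))
    (hX : ProbabilityTheory.HasLaw X (ProbabilityTheory.multivariateGaussian mu S) Pr)
    (P : Matrix (Fin n) (Fin n) ℝ) (lam b : Fin n → ℝ)
    (hparam : QuadFormSeries.IsParam A S mu P lam b) :
    (∀ y : ℝ, 0 ≤ y →
      HasSum (fun k : ℕ => (-1 : ℝ) ^ k * QuadFormSeries.cCoeff lam b k *
          (y ^ ((n : ℝ) / 2 + (k : ℝ)) / Real.Gamma ((n : ℝ) / 2 + (k : ℝ) + 1)))
        (Pr.real {ω | QuadFormSeries.quadForm A (X ω) ≤ y})) ∧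
    (∀ y : ℝ, y < 0 → Pr.real {ω | QuadFormSeries.quadForm A (X ω) ≤ y} = 0) ∧
    ∃ p : ℝ → ℝ,
      (∀ y : ℝ, 0 < y →
        HasSum (fun k : ℕ => (-1 : ℝ) ^ k * QuadFormSeries.cCoeff lam b k *
            (y ^ ((n : ℝ) / 2 + (k : ℝ) - 1) / Real.Gamma ((n : ℝ) / 2 + (k : ℝ))))
          (p y)) ∧
      (∀ y : ℝ, y ≤ 0 → p y = 0) ∧
      (∀ y : ℝ, 0 ≤ p y) ∧
      MeasureTheory.HasPDF (fun ω => QuadFormSeries.quadForm A (X ω)) Pr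
        MeasureTheory.volume ∧
      MeasureTheory.pdf (fun ω => QuadFormSeries.quadForm A (X ω)) Pr MeasureTheory.volume
        =ᵐ[MeasureTheory.volume] fun y => ENNReal.ofReal (p y) := by
  have hn0 : (0 : ℝ) < (n : ℝ) / 2 := by
    have : (0 : ℝ) < n := by exact_mod_cast hn
    positivity
  have hq : Measurable (QuadFormSeries.quadForm A) := by
    unfold QuadFormSeries.quadForm
    fun_prop
  set Q : Ω → ℝ := fun ω => QuadFormSeries.quadForm A (X ω) with hQ
  have hQm : AEMeasurable Q Pr := hq.comp_aemeasurable hX.aemeasurable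
  have hd := QuadFormSeries.hasKernelDensity_map_sum_mul_add_sq hn (hparam.lam_pos hA hS) b
  have hmap : Pr.map Q = (ProbabilityTheory.multivariateGaussian mu S).map
      (QuadFormSeries.quadForm A) := by
    rw [← hX.map_eq, AEMeasurable.map_map_of_aemeasurable hq.aemeasurable hX.aemeasurable]
    rfl
  rw [← QuadFormSeries.map_quadForm_eq hS hparam, ← hmap] at hd
  set g := PowerSeries.rescale (-1) (∏ i, QuadFormSeries.squareSeries (lam i) (b i)) with hg
  have hcoeff : ∀ k, PowerSeries.coeff k g =
      (-1 : ℝ) ^ k * QuadFormSeries.cCoeff lam b k := fun k => by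
    rw [hg, PowerSeries.coeff_rescale, QuadFormSeries.coeff_prod_squareSeries]
  have hcdf : ∀ y, Pr.real {ω | Q ω ≤ y} = QuadFormSeries.kernelSeries ((n : ℝ) / 2 + 1) g y :=
    fun y => by
      rw [← hd.measure_Iic hn0, MeasureTheory.measureReal_def, MeasureTheory.measureReal_def,
        MeasureTheory.Measure.map_apply_of_aemeasurable hQm measurableSet_Iic]
      rfl
  have hpm := (hd.expSummable.measurable_kernelSeries hn0).ennreal_ofReal
  have hpdf : MeasureTheory.HasPDF Q Pr MeasureTheory.volume :=
    MeasureTheory.hasPDF_of_map_eq_withDensity hQm _ hpm.aemeasurable hd.eq_withDensity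
  refine ⟨fun y hy => ?_, fun y hy => ?_, QuadFormSeries.kernelSeries ((n : ℝ) / 2) g,
    fun y hy => ?_, fun y hy => QuadFormSeries.kernelSeries_of_nonpos _ _ hy, hd.nonneg, hpdf, ?_⟩
  · rw [hcdf]
    have h := hd.expSummable.hasSum (show 0 < (n : ℝ) / 2 + 1 by positivity) y
    simp only [hcoeff] at h
    -- at `y = 0` the real power `0 ^ (n / 2 + k)` vanishes, as does the kernel
    convert h using 3 with k
    rcases hy.eq_or_lt with rfl | hy0
    · rw [QuadFormSeries.powerKernel_of_nonpos _ le_rfl, Real.zero_rpow (by positivity), zero_div]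
    · rw [QuadFormSeries.powerKernel_of_pos _ hy0]
      ring_nf
  · rw [hcdf, QuadFormSeries.kernelSeries_of_nonpos _ _ hy.le]
  · have h := hd.expSummable.hasSum hn0 y
    simpa only [hcoeff, QuadFormSeries.powerKernel_of_pos _ hy] using h
  · rw [MeasureTheory.pdf_def, hd.eq_withDensity]
    exact MeasureTheory.Measure.rnDeriv_withDensity _ hpm
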